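/- All graphs are finite, simple and undirected. An induced matching in a graph $G$ is a set $M\subseteq E(G)$ of edges such that no two distinct edges of $M$ share an endpoint and no edge of $G$ joins an endpoint of one edge of $M$ to an endpoint of another. A graph is well-indumatched if all of its inclusion-wise maximal induced matchings have the same size. A graph is unicyclic if it is connected and contains exactly one cycle (as a subgraph), and the girth of a graph is the length of its shortest cycle. **Corollary.** The only well-indumatched unicyclic graph of girth $11$ is the cycle $C_{11}$. That is, a graph $G$ is unicyclic, of girth $11$ and well-indumatched if and only if $G$ is isomorphic to $C_{11}$. -/

import Mathlib

namespace SimpleGraph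

variable {V : Type*}

/-- `M` is a matching of `G`: a set of edges of `G`, no two of which have a common endpoint. -/
def IsEdgeMatching (G : SimpleGraph V) (M : Finset (Sym2 V)) : Prop :=
  (∀ e ∈ M, e ∈ G.edgeSet) ∧
    ∀ e ∈ M, ∀ f ∈ M, e ≠ f → ∀ v, ¬ (v ∈ e ∧ v ∈ f)

/-- `M` is an induced matching of `G`: a matching such that no two of its edges are joined by an
edge of `G`. -/
def IsInducedMatching (G : SimpleGraph V) (M : Finset (Sym2 V)) : Prop :=
  G.IsEdgeMatching M ∧
    ∀ e ∈ M, ∀ f ∈ M, e ≠ f → ∀ u ∈ e, ∀ v ∈ f, ¬ G.Adj u v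

/-- `G` is well-indumatched: all its inclusion-wise maximal induced matchings have the same
size. -/
def IsWellIndumatched (G : SimpleGraph V) : Prop :=
  ∀ M N : Finset (Sym2 V),
    Maximal G.IsInducedMatching M → Maximal G.IsInducedMatching N → M.card = N.card

/-- The subgraph `C` of `G` is a cycle: it consists of the vertices and edges of a closed walk
that is a cycle. -/
def Subgraph.IsCycleSubgraph {G : SimpleGraph V} (C : G.Subgraph) : Prop :=
  ∃ (v : V) (w : G.Walk v v), w.IsCycle ∧ w.toSubgraph = C

/-- `G` is unicyclic: it is connected and has a unique cycle (as a subgraph). -/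
def IsUnicyclic (G : SimpleGraph V) : Prop :=
  G.Connected ∧ ∃! C : G.Subgraph, C.IsCycleSubgraph

end SimpleGraph

/-! A unicyclic graph of girth 11 is an 11-cycle with hanging trees, since every edge off the cycle
is a bridge (`Connected.exists_hangsFrom`). The tool is an exchange (`IsWellIndumatched.card_le`):
if every edge far from an induced matching `M` is far from an induced matching `N`, then `N` is no
larger than `M`. Each forbidden configuration yields such a pair with `N` larger by one.

A branch at a child `t` of the cycle that has a grandchild can be cut off: an edge between a child
and a grandchild of `t` blocks `t` (`exists_trimming`). What remains at the cycle are leaves and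
stars. A star at `c 0` forces one at `c 2`, hence stars everywhere, but adjacent cycle vertices
cannot both carry stars. Without stars, a leaf at `c 0` forces one at `c 3`, hence leaves
everywhere, but leaves at distance two are impossible. If all branches are deep, one of them
isolates a path on eight vertices, which has maximal induced matchings of sizes 2 and 3.

Conversely, in the 11-cycle packing and covering bounds leave 3 as the only size
(`card_eq_three_of_iso`). -/

namespace SimpleGraph

variable {V : Type*} {G : SimpleGraph V}

/-! ### Far edges and induced matchings -/

/-- Two vertices are far if they are distinct and non-adjacent. -/
def Far (G : SimpleGraph V) (x y : V) : Prop := x ≠ y ∧ ¬ G.Adj x y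

lemma Far.symm {x y : V} (h : G.Far x y) : G.Far y x := ⟨h.1.symm, fun h' => h.2 h'.symm⟩

/-- Two edges are far if each end of the one is far from each end of the other. -/
def EdgeFar (G : SimpleGraph V) (e f : Sym2 V) : Prop := ∀ x ∈ e, ∀ y ∈ f, G.Far x y

lemma EdgeFar.symm {e f : Sym2 V} (h : G.EdgeFar e f) : G.EdgeFar f e :=
  fun x hx y hy => (h y hy x hx).symm

lemma EdgeFar.ne {e f : Sym2 V} (h : G.EdgeFar e f) : e ≠ f := by
  rintro rfl
  induction e with
  | _ x y => exact (h x (by simp) x (by simp)).1 rfl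

lemma edgeFar_mk {a b x y : V} : G.EdgeFar s(a, b) s(x, y) ↔
    (G.Far a x ∧ G.Far a y) ∧ G.Far b x ∧ G.Far b y := by
  simp [EdgeFar]

lemma isInducedMatching_iff {M : Finset (Sym2 V)} : G.IsInducedMatching M ↔
    (∀ e ∈ M, e ∈ G.edgeSet) ∧ ∀ e ∈ M, ∀ f ∈ M, e ≠ f → G.EdgeFar e f := by
  constructor
  · rintro ⟨⟨h1, h2⟩, h3⟩
    refine ⟨h1, fun e he f hf hne x hx y hy => ⟨?_, h3 e he f hf hne x hx y hy⟩⟩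
    rintro rfl
    exact h2 e he f hf hne x ⟨hx, hy⟩
  · rintro ⟨h1, h2⟩
    exact ⟨⟨h1, fun e he f hf hne v hv => (h2 e he f hf hne v hv.1 v hv.2).1 rfl⟩,
      fun e he f hf hne x hx y hy => (h2 e he f hf hne x hx y hy).2⟩

lemma IsInducedMatching.union [DecidableEq V] {M N : Finset (Sym2 V)}
    (hM : G.IsInducedMatching M) (hN : G.IsInducedMatching N)
    (h : ∀ e ∈ M, ∀ f ∈ N, G.EdgeFar e f) : G.IsInducedMatching (M ∪ N) := by
  rw [isInducedMatching_iff] at *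
  constructor
  · intro e he
    rcases Finset.mem_union.1 he with he | he
    exacts [hM.1 e he, hN.1 e he]
  · intro e he f hf hne
    rcases Finset.mem_union.1 he with he | he <;> rcases Finset.mem_union.1 hf with hf | hf
    exacts [hM.2 e he f hf hne, h e he f hf, (h f hf e he).symm, hN.2 e he f hf hne]

lemma IsInducedMatching.mono {M N : Finset (Sym2 V)} (hM : G.IsInducedMatching M) (h : N ⊆ M) :
    G.IsInducedMatching N := by
  rw [isInducedMatching_iff] at *
  exact ⟨fun e he => hM.1 e (h he), fun e he f hf => hM.2 e (h he) f (h hf)⟩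

/-! ### The exchange principle -/

/-- In a well-indumatched graph, an induced matching that blocks every edge blocked by another
induced matching is at least as large. -/
lemma IsWellIndumatched.card_le [Finite V] (hG : G.IsWellIndumatched) {M N : Finset (Sym2 V)}
    (hM : G.IsInducedMatching M) (hN : G.IsInducedMatching N)
    (h : ∀ e ∈ G.edgeSet, (∀ f ∈ M, G.EdgeFar e f) → ∀ f ∈ N, G.EdgeFar e f) :
    N.card ≤ M.card := by
  classical
  obtain ⟨M', hMM', hM'⟩ := Finite.exists_le_maximal hM
  -- What completes `M` is far from `M`, hence from `N`, so it can be added to `N` as well.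
  have hJ : ∀ e ∈ M' \ M, ∀ f ∈ N, G.EdgeFar e f := by
    intro e he
    rw [Finset.mem_sdiff] at he
    have h' := isInducedMatching_iff.1 hM'.prop
    refine h e (h'.1 e he.1) fun f hf => h'.2 e he.1 f (hMM' hf) ?_
    rintro rfl
    exact he.2 hf
  have hNJ : G.IsInducedMatching (M' \ M ∪ N) :=
    (hM'.prop.mono Finset.sdiff_subset).union hN hJ
  obtain ⟨N', hNN', hN'⟩ := Finite.exists_le_maximal hNJ
  have hdisj : Disjoint (M' \ M) N :=
    Finset.disjoint_left.2 fun e he hf => (hJ e he e hf).ne rfl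
  have h1 := Finset.card_le_card hNN'
  rw [Finset.card_union_of_disjoint hdisj, Finset.card_sdiff_of_subset hMM', hG N' M' hN' hM'] at h1
  have := Finset.card_le_card hMM'
  simp only [ge_iff_le] at *
  omega

/-- The edge set given by a list of pairs of vertices. -/
def pairEdges [DecidableEq V] (A : List (V × V)) : Finset (Sym2 V) :=
  (A.map fun p => s(p.1, p.2)).toFinset

lemma mem_pairEdges [DecidableEq V] {A : List (V × V)} {e : Sym2 V} :
    e ∈ pairEdges A ↔ ∃ p ∈ A, s(p.1, p.2) = e := by
  simp [pairEdges]

/-- The pairs in a list are edges that are pairwise far. -/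
def IsMatchingList (G : SimpleGraph V) (A : List (V × V)) : Prop :=
  (∀ p ∈ A, G.Adj p.1 p.2) ∧ A.Pairwise fun p q => G.EdgeFar s(p.1, p.2) s(q.1, q.2)

lemma IsMatchingList.isInducedMatching [DecidableEq V] {A : List (V × V)}
    (hA : G.IsMatchingList A) : G.IsInducedMatching (pairEdges A) := by
  rw [isInducedMatching_iff]
  simp only [mem_pairEdges]
  constructor
  · rintro e ⟨p, hp, rfl⟩
    exact hA.1 p hp
  · rintro e ⟨p, hp, rfl⟩ f ⟨q, hq, rfl⟩ hne
    have : Std.Symm fun p q : V × V => G.EdgeFar s(p.1, p.2) s(q.1, q.2) := ⟨fun _ _ h => h.symm⟩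
    refine hA.2.forall hp hq ?_
    rintro rfl
    exact hne rfl

lemma IsMatchingList.card [DecidableEq V] {A : List (V × V)}
    (hA : G.IsMatchingList A) : (pairEdges A).card = A.length := by
  rw [pairEdges, List.toFinset_card_of_nodup, List.length_map]
  rw [List.Nodup, List.pairwise_map]
  exact hA.2.imp fun h => h.ne

/-- The exchange principle for lists of edges, relative to a common part `T`. -/
lemma IsWellIndumatched.length_le [Finite V] (hG : G.IsWellIndumatched)
    {T : Finset (Sym2 V)} {A B : List (V × V)} (hT : G.IsInducedMatching T)
    (hA : G.IsMatchingList A) (hB : G.IsMatchingList B)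
    (hTA : ∀ p ∈ A ++ B, ∀ e ∈ T, ∀ x ∈ e, G.Far x p.1 ∧ G.Far x p.2)
    (h : ∀ x y, G.Adj x y → (∀ e ∈ T, ∀ z ∈ e, G.Far x z ∧ G.Far y z) →
      (∀ p ∈ A, (G.Far x p.1 ∧ G.Far x p.2) ∧ G.Far y p.1 ∧ G.Far y p.2) →
      ∀ p ∈ B, G.Far x p.1 ∧ G.Far x p.2) :
    B.length ≤ A.length := by
  classical
  have key : ∀ C : List (V × V), C ⊆ A ++ B → ∀ e ∈ T, ∀ f ∈ pairEdges C, G.EdgeFar e f := by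
    intro C hC e he f hf
    obtain ⟨p, hp, rfl⟩ := mem_pairEdges.1 hf
    intro x hx y hy
    have := hTA p (hC hp) e he x hx
    rcases Sym2.mem_iff.1 hy with rfl | rfl
    exacts [this.1, this.2]
  have hdisj : ∀ C : List (V × V), C ⊆ A ++ B → Disjoint T (pairEdges C) := fun C hC =>
    Finset.disjoint_left.2 fun e he hf => (key C hC e he e hf).ne rfl
  have hA' : A ⊆ A ++ B := List.subset_append_left _ _
  have hB' : B ⊆ A ++ B := List.subset_append_right _ _
  have := hG.card_le (hT.union hA.isInducedMatching (key A hA'))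
    (hT.union hB.isInducedMatching (key B hB')) ?_
  · rw [Finset.card_union_of_disjoint (hdisj A hA'), Finset.card_union_of_disjoint (hdisj B hB'),
      hA.card, hB.card] at this
    omega
  · intro e he hfar f hf
    rcases Finset.mem_union.1 hf with hf | hf
    · exact hfar f (Finset.mem_union_left _ hf)
    induction e with
    | _ x y =>
    obtain ⟨p, hp, rfl⟩ := mem_pairEdges.1 hf
    have h1 : ∀ e ∈ T, ∀ z ∈ e, G.Far x z ∧ G.Far y z := fun e he z hz =>
      ⟨hfar e (Finset.mem_union_left _ he) x (by simp) z hz,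
        hfar e (Finset.mem_union_left _ he) y (by simp) z hz⟩
    have h2 : ∀ p ∈ A, (G.Far x p.1 ∧ G.Far x p.2) ∧ G.Far y p.1 ∧ G.Far y p.2 := fun p hp =>
      edgeFar_mk.1 (hfar _ (Finset.mem_union_right _ (mem_pairEdges.2 ⟨p, hp, rfl⟩)))
    -- `h` speaks of one end only, so it is applied to both orientations of the edge.
    exact edgeFar_mk.2 ⟨h x y he h1 h2 p hp,
      h y x (Adj.symm he) (fun e he z hz => (h1 e he z hz).symm) (fun p hp => (h2 p hp).symm) p hp⟩

/-! ### An 11-cycle with hanging trees -/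

/-- `G` consists of the cycle `c` of length eleven and of trees hanging from it: `d` is the distance
to the cycle and `par` maps a vertex off the cycle to its only neighbour closer to the cycle. -/
structure HangsFrom (G : SimpleGraph V) (c : Fin 11 → V) (par : V → V) (d : V → ℕ) : Prop where
  inj : Function.Injective c
  depth_c : ∀ i, d (c i) = 0
  exists_c : ∀ v, d v = 0 → ∃ i, c i = v
  depth_par : ∀ v, d v ≠ 0 → d (par v) + 1 = d v
  adj_iff : ∀ u v, G.Adj u v ↔
    (∃ i, (u = c i ∧ v = c (i + 1)) ∨ (v = c i ∧ u = c (i + 1))) ∨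
      (d v ≠ 0 ∧ par v = u) ∨ (d u ≠ 0 ∧ par u = v)

/-- `x` is a child of `p` in one of the hanging trees. -/
def Child (par : V → V) (d : V → ℕ) (x p : V) : Prop := d x ≠ 0 ∧ par x = p

/-- `x` has no children. -/
def Childless (par : V → V) (d : V → ℕ) (x : V) : Prop := ∀ y, ¬ Child par d y x

/-- `x` has a grandchild. -/
def HasGrandchild (par : V → V) (d : V → ℕ) (x : V) : Prop :=
  ∃ u v, Child par d u x ∧ Child par d v u

/-- `t` with its children is a star hanging from `p`. -/
def IsStar (par : V → V) (d : V → ℕ) (p t : V) : Prop :=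
  Child par d t p ∧ (∃ u, Child par d u t) ∧ ∀ u, Child par d u t → Childless par d u

namespace HangsFrom

variable {c : Fin 11 → V} {par : V → V} {d : V → ℕ}

/-- Lets every local configuration be studied at `c 0`. -/
lemma rotate (H : G.HangsFrom c par d) (k : Fin 11) :
    G.HangsFrom (fun i => c (k + i)) par d where
  inj := fun i j h => by simpa using H.inj h
  depth_c := fun i => H.depth_c _
  exists_c := fun v hv => by
    obtain ⟨i, hi⟩ := H.exists_c v hv
    exact ⟨i - k, by simpa using hi⟩
  depth_par := H.depth_par
  adj_iff := fun u v => by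
    rw [H.adj_iff]
    refine or_congr_left ⟨?_, ?_⟩
    · rintro ⟨i, hi⟩
      refine ⟨i - k, ?_⟩
      rw [← add_assoc]
      simpa using hi
    · rintro ⟨i, hi⟩
      exact ⟨k + i, by rwa [← add_assoc] at hi⟩

lemma depth_child (H : G.HangsFrom c par d) {x p : V} (h : Child par d x p) : d x = d p + 1 := by
  rw [← H.depth_par x h.1, h.2]

lemma adj_child (H : G.HangsFrom c par d) {x p : V} (h : Child par d x p) : G.Adj x p :=
  (H.adj_iff _ _).2 (Or.inr (Or.inr h))

lemma adj_c (H : G.HangsFrom c par d) (i j : Fin 11) (h : i + 1 = j) : G.Adj (c i) (c j) :=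
  (H.adj_iff _ _).2 (Or.inl ⟨i, Or.inl ⟨rfl, by rw [h]⟩⟩)

lemma far_of_not_child (H : G.HangsFrom c par d) {x y : V} (hne : x ≠ y) (hd : d x ≠ 0 ∨ d y ≠ 0)
    (h1 : ¬ Child par d x y) (h2 : ¬ Child par d y x) : G.Far x y := by
  refine ⟨hne, fun h => ?_⟩
  rcases (H.adj_iff _ _).1 h with ⟨i, ⟨rfl, rfl⟩ | ⟨rfl, rfl⟩⟩ | h | h
  · simp [H.depth_c] at hd
  · simp [H.depth_c] at hd
  · exact h2 h
  · exact h1 h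

lemma far_c (H : G.HangsFrom c par d) {i j : Fin 11} (h : i ≠ j ∧ i + 1 ≠ j ∧ j + 1 ≠ i) :
    G.Far (c i) (c j) := by
  refine ⟨fun h' => h.1 (H.inj h'), fun h' => ?_⟩
  rcases (H.adj_iff _ _).1 h' with ⟨k, ⟨h1, h2⟩ | ⟨h1, h2⟩⟩ | h' | h'
  · rw [← H.inj h1] at h2
    exact h.2.1 (H.inj h2).symm
  · rw [← H.inj h1] at h2
    exact h.2.2 (H.inj h2).symm
  · exact h'.1 (H.depth_c _)
  · exact h'.1 (H.depth_c _)

lemma far_child_c (H : G.HangsFrom c par d) {i j : Fin 11} {t : V} (ht : Child par d t (c i))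
    (h : i ≠ j) : G.Far t (c j) := by
  refine H.far_of_not_child ?_ (Or.inl ht.1) ?_ ?_
  · rintro rfl
    exact ht.1 (H.depth_c j)
  · intro h'
    exact h (H.inj (ht.2.symm.trans h'.2))
  · exact fun h' => h'.1 (H.depth_c j)

lemma far_grandchild_c (H : G.HangsFrom c par d) {i j : Fin 11} {t u : V}
    (ht : Child par d t (c i)) (hu : Child par d u t) : G.Far u (c j) := by
  refine H.far_of_not_child ?_ (Or.inl hu.1) ?_ ?_
  · rintro rfl
    exact hu.1 (H.depth_c j)
  · intro h'
    exact ht.1 (by rw [← hu.2, h'.2, H.depth_c j])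
  · exact fun h' => h'.1 (H.depth_c j)

lemma far_child_child (H : G.HangsFrom c par d) {t t' p p' : V} (ht : Child par d t p)
    (ht' : Child par d t' p') (hp : p ≠ p') (hd : d p = d p') : G.Far t t' := by
  have h1 := H.depth_child ht
  have h2 := H.depth_child ht'
  refine H.far_of_not_child ?_ (Or.inl ht.1) ?_ ?_
  · rintro rfl
    exact hp (ht.2.symm.trans ht'.2)
  · intro h'
    have := H.depth_child h'
    omega
  · intro h'
    have := H.depth_child h'
    omega

lemma far_child_grandchild (H : G.HangsFrom c par d) {t t' u p p' : V} (ht : Child par d t p)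
    (ht' : Child par d t' p') (hu : Child par d u t') (hp : p ≠ p') (hd : d p = d p') :
    G.Far t u := by
  have h1 := H.depth_child ht
  have h2 := H.depth_child ht'
  have h3 := H.depth_child hu
  refine H.far_of_not_child ?_ (Or.inl ht.1) ?_ ?_
  · rintro rfl
    omega
  · intro h'
    have := H.depth_child h'
    omega
  · intro h'
    exact (H.far_child_child ht ht' hp hd).1 (h'.2.symm.trans hu.2)

lemma near_c (H : G.HangsFrom c par d) (i j k : Fin 11) (hij : i + 1 = j) (hjk : j + 1 = k) {x : V}
    (h : ¬ G.Far x (c j)) : x = c j ∨ x = c i ∨ x = c k ∨ Child par d x (c j) := by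
  by_cases hx : x = c j
  · exact Or.inl hx
  have h : G.Adj x (c j) := by
    by_contra h'
    exact h ⟨hx, h'⟩
  rcases (H.adj_iff _ _).1 h with ⟨l, ⟨h1, h2⟩ | ⟨h1, h2⟩⟩ | h' | h'
  · rw [← hij] at h2
    rw [add_right_cancel (H.inj h2)]
    exact Or.inr (Or.inl h1)
  · rw [← H.inj h1, hjk] at h2
    exact Or.inr (Or.inr (Or.inl h2))
  · exact absurd (H.depth_c j) h'.1
  · exact Or.inr (Or.inr (Or.inr h'))

lemma eq_or_child (H : G.HangsFrom c par d) {x p y : V} (hx : Child par d x p) (h : G.Adj x y) :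
    y = p ∨ Child par d y x := by
  rcases (H.adj_iff _ _).1 h with ⟨l, ⟨rfl, rfl⟩ | ⟨rfl, rfl⟩⟩ | h' | h'
  · exact absurd (H.depth_c _) hx.1
  · exact absurd (H.depth_c _) hx.1
  · exact Or.inr h'
  · exact Or.inl (h'.2.symm.trans hx.2)

/-! ### Cutting off deep branches -/

/-- The vertices that are far from the edges below the vertices of `X`. -/
def Core (par : V → V) (d : V → ℕ) (X : Set V) (x : V) : Prop :=
  d x ≤ 2 ∧ (d x = 1 → x ∉ X) ∧ (d x = 2 → par x ∉ X)

/-- `T` takes, for each `t` in `X`, one edge from a child of `t` to a grandchild. It blocks `t`,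
while its ends are too deep to touch anything else in the core. -/
lemma exists_trimming [Finite V] (H : G.HangsFrom c par d) (X : Set V)
    (hX : ∀ t ∈ X, d t = 1 ∧ HasGrandchild par d t) :
    ∃ T : Finset (Sym2 V), G.IsInducedMatching T ∧
      (∀ x, Core par d X x → ∀ e ∈ T, ∀ z ∈ e, G.Far z x) ∧
      ∀ t ∈ X, ∃ e ∈ T, ∃ z ∈ e, G.Adj t z := by
  classical
  choose! hX1 u v hu hv using hX
  have hdu : ∀ t ∈ X, d (u t) = 2 := fun t ht => by rw [H.depth_child (hu t ht), hX1 t ht]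
  have hdv : ∀ t ∈ X, d (v t) = 3 := fun t ht => by rw [H.depth_child (hv t ht), hdu t ht]
  have huu : ∀ t ∈ X, ∀ t' ∈ X, t ≠ t' → G.Far (u t) (u t') := fun t ht t' ht' hne =>
    H.far_child_child (hu t ht) (hu t' ht') hne (by rw [hX1 t ht, hX1 t' ht'])
  have huv : ∀ t ∈ X, ∀ t' ∈ X, t ≠ t' → G.Far (u t) (v t') := fun t ht t' ht' hne =>
    H.far_child_grandchild (hu t ht) (hu t' ht') (hv t' ht') hne (by rw [hX1 t ht, hX1 t' ht'])
  have hvv : ∀ t ∈ X, ∀ t' ∈ X, t ≠ t' → G.Far (v t) (v t') := fun t ht t' ht' hne =>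
    H.far_child_child (hv t ht) (hv t' ht') (huu t ht t' ht' hne).1
      (by rw [hdu t ht, hdu t' ht'])
  refine ⟨X.toFinite.toFinset.image fun t => s(u t, v t), ?_, ?_, ?_⟩
  · rw [isInducedMatching_iff]
    simp only [Finset.mem_image, Set.Finite.mem_toFinset]
    constructor
    · rintro e ⟨t, ht, rfl⟩
      exact (H.adj_child (hv t ht)).symm
    · rintro e ⟨t, ht, rfl⟩ f ⟨t', ht', rfl⟩ hne
      have hne : t ≠ t' := by
        rintro rfl
        exact hne rfl
      exact edgeFar_mk.2 ⟨⟨huu t ht t' ht' hne, huv t ht t' ht' hne⟩,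
        (huv t' ht' t ht hne.symm).symm, hvv t ht t' ht' hne⟩
  · rintro x ⟨hx, hx1, hx2⟩ e he z hz
    simp only [Finset.mem_image, Set.Finite.mem_toFinset] at he
    obtain ⟨t, ht, rfl⟩ := he
    have h1 := hX1 t ht
    have h2 := hdu t ht
    have h3 := hdv t ht
    rcases Sym2.mem_iff.1 hz with rfl | rfl
    · refine H.far_of_not_child ?_ (Or.inl (hu t ht).1) (fun h => ?_) fun h => ?_
      · rintro rfl
        exact hx2 h2 (by rwa [(hu t ht).2])
      · rw [← h.2, (hu t ht).2] at hx1
        exact hx1 h1 ht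
      · have := H.depth_child h
        omega
    · refine H.far_of_not_child ?_ (Or.inl (hv t ht).1) (fun h => ?_) fun h => ?_
      · rintro rfl
        omega
      · rw [← h.2, (hv t ht).2] at hx2
        exact hx2 h2 (by rwa [(hu t ht).2])
      · have := H.depth_child h
        omega
  · intro t ht
    exact ⟨s(u t, v t), Finset.mem_image.2 ⟨t, by simpa using ht, rfl⟩, u t, by simp,
      (H.adj_child (hu t ht)).symm⟩

/-- The edges of `T` are added to both matchings, so edges meeting `X` are already blocked and need
no check. -/
lemma length_le [Finite V] (H : G.HangsFrom c par d) (hG : G.IsWellIndumatched) {X : Set V}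
    (hX : ∀ t ∈ X, d t = 1 ∧ HasGrandchild par d t) {A B : List (V × V)}
    (hA : G.IsMatchingList A) (hB : G.IsMatchingList B)
    (hAB : ∀ p ∈ A ++ B, Core par d X p.1 ∧ Core par d X p.2)
    (h : ∀ x y, G.Adj x y → x ∉ X → y ∉ X →
      (∀ p ∈ A, (G.Far x p.1 ∧ G.Far x p.2) ∧ G.Far y p.1 ∧ G.Far y p.2) →
      ∀ p ∈ B, G.Far x p.1 ∧ G.Far x p.2) :
    B.length ≤ A.length := by
  obtain ⟨T, hT, hTc, hTX⟩ := H.exists_trimming X hX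
  refine hG.length_le hT hA hB
    (fun p hp e he x hx => ⟨hTc _ (hAB p hp).1 e he x hx, hTc _ (hAB p hp).2 e he x hx⟩)
    fun x y hxy hTxy => h x y hxy (fun hx => ?_) fun hy => ?_
  · obtain ⟨e, he, z, hz, hxz⟩ := hTX x hx
    exact (hTxy e he z hz).1.2 hxz
  · obtain ⟨e, he, z, hz, hyz⟩ := hTX y hy
    exact (hTxy e he z hz).2.2 hyz

lemma core_c (H : G.HangsFrom c par d) {X : Set V} (i : Fin 11) : Core par d X (c i) := by
  simp [Core, H.depth_c]

lemma core_child (H : G.HangsFrom c par d) {X : Set V} {i : Fin 11} {t : V}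
    (ht : Child par d t (c i)) (h : t ∉ X) : Core par d X t := by
  simp [Core, H.depth_child ht, H.depth_c, h]

lemma core_grandchild (H : G.HangsFrom c par d) {X : Set V} {i : Fin 11} {t u : V}
    (ht : Child par d t (c i)) (hu : Child par d u t) (h : t ∉ X) : Core par d X u := by
  simp [Core, H.depth_child ht, H.depth_c, h, H.depth_child hu, hu.2]

/-! ### Excluded configurations at the cycle -/

lemma not_isStar_one [Finite V] (H : G.HangsFrom c par d) (hG : G.IsWellIndumatched) {t t' : V}
    (ht : IsStar par d (c 0) t) (ht' : IsStar par d (c 1) t') : False := by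
  obtain ⟨ht, ⟨u, hu⟩, hl⟩ := ht
  obtain ⟨ht', ⟨u', hu'⟩, hl'⟩ := ht'
  have hX : t ∉ (∅ : Set V) ∧ t' ∉ (∅ : Set V) := by simp
  have h01 := H.adj_c 0 1 rfl
  have hd : d (c 0) = d (c 1) := by simp [H.depth_c]
  have hne : c 0 ≠ c 1 := h01.ne
  have htt := H.far_child_child ht ht' hne hd
  -- Every edge near a star edge meets `t`, `t'`, `c 0` or `c 1`, and is thus near `c 0 c 1`: one
  -- edge does the work of two.
  have := H.length_le hG (X := ∅) (by simp) (A := [(c 0, c 1)]) (B := [(t, u), (t', u')]) ?_ ?_ ?_ ?_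
  · simp at this
  · simp [IsMatchingList, h01]
  · simp only [IsMatchingList, edgeFar_mk, List.mem_cons, List.not_mem_nil, or_false,
      forall_eq_or_imp, forall_eq, List.pairwise_cons, List.Pairwise.nil, and_true,
      IsEmpty.forall_iff, implies_true, (H.adj_child hu).symm, (H.adj_child hu').symm, true_and]
    exact ⟨⟨htt, H.far_child_grandchild ht ht' hu' hne hd⟩,
      (H.far_child_grandchild ht' ht hu hne.symm hd.symm).symm,
      H.far_child_child hu hu' htt.1 (by rw [H.depth_child ht, H.depth_child ht', hd])⟩
  · simp only [List.cons_append, List.nil_append, List.mem_cons, List.not_mem_nil, or_false,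
      forall_eq_or_imp, forall_eq]
    exact ⟨⟨H.core_c _, H.core_c _⟩, ⟨H.core_child ht hX.1, H.core_grandchild ht hu hX.1⟩,
      ⟨H.core_child ht' hX.2, H.core_grandchild ht' hu' hX.2⟩⟩
  · simp only [List.mem_cons, List.not_mem_nil, or_false, forall_eq_or_imp, forall_eq]
    intro x y hxy _ _ hf
    have h1 := H.adj_child ht
    have h2 := H.adj_child ht'
    have e0 := fun z (h : G.Adj t z) => H.eq_or_child ht h
    have e1 := fun z (h : G.Adj u z) => H.eq_or_child hu h
    have e2 := fun z (h : G.Adj t' z) => H.eq_or_child ht' h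
    have e3 := fun z (h : G.Adj u' z) => H.eq_or_child hu' h
    have e4 := fun z p (h : Child par d z p) w (h' : G.Adj z w) => H.eq_or_child h h'
    have s := G.adj_comm
    simp only [Childless, Far] at *
    grind

lemma edgeFar_c (H : G.HangsFrom c par d) {i i' j j' : Fin 11}
    (h : (i ≠ j ∧ i + 1 ≠ j ∧ j + 1 ≠ i) ∧ (i ≠ j' ∧ i + 1 ≠ j' ∧ j' + 1 ≠ i) ∧
      (i' ≠ j ∧ i' + 1 ≠ j ∧ j + 1 ≠ i') ∧ (i' ≠ j' ∧ i' + 1 ≠ j' ∧ j' + 1 ≠ i')) :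
    (G.Far (c i) (c j) ∧ G.Far (c i) (c j')) ∧ G.Far (c i') (c j) ∧ G.Far (c i') (c j') :=
  ⟨⟨H.far_c h.1, H.far_c h.2.1⟩, H.far_c h.2.2.1, H.far_c h.2.2.2⟩

lemma depth_eq_one (H : G.HangsFrom c par d) {i : Fin 11} {t : V} (ht : Child par d t (c i)) :
    d t = 1 := by
  rw [H.depth_child ht, H.depth_c]

/-- The depth-one vertices with a grandchild. -/
def deep (par : V → V) (d : V → ℕ) : Set V := {t | d t = 1 ∧ HasGrandchild par d t}

lemma childless_or_isStar (H : G.HangsFrom c par d) {i : Fin 11} {t : V}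
    (ht : Child par d t (c i)) (h : t ∉ deep par d) :
    Childless par d t ∨ IsStar par d (c i) t := by
  by_cases h' : Childless par d t
  · exact Or.inl h'
  refine Or.inr ⟨ht, by simpa [Childless] using h', fun u hu v hv => ?_⟩
  exact h ⟨H.depth_eq_one ht, u, v, hu, hv⟩

lemma _root_.SimpleGraph.Childless.not_mem_deep {t : V} (h : Childless par d t) : t ∉ deep par d :=
  fun ⟨_, u, _, hu, _⟩ => h u hu

lemma _root_.SimpleGraph.IsStar.not_mem_deep {p t : V} (h : IsStar par d p t) : t ∉ deep par d :=
  fun ⟨_, u, v, hu, hv⟩ => h.2.2 u hu v hv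

/-- Without a star at `c 2`, its untrimmed children are leaves, so `c 0 c 1` blocks all edges near
`t u` or `c 1 c 2` except some at `c 3`. The edge `c 4 c 5`, common to both matchings, blocks those.
-/
lemma exists_isStar_two [Finite V] (H : G.HangsFrom c par d) (hG : G.IsWellIndumatched) {t : V}
    (ht : IsStar par d (c 0) t) : ∃ t', IsStar par d (c 2) t' := by
  by_contra! hs
  have hX := ht.not_mem_deep
  have hcl := fun z (hz : Child par d z (c 2)) => H.childless_or_isStar hz
  obtain ⟨ht, ⟨u, hu⟩, hl⟩ := ht
  have h0 := H.adj_c 0 1 rfl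
  have h1 := H.adj_c 1 2 rfl
  have h2 := H.adj_c 2 3 rfl
  have h3 := H.adj_c 3 4 rfl
  have h4 := H.adj_c 4 5 rfl
  have := H.length_le hG (X := deep par d) (fun _ h => h) (A := [(c 0, c 1), (c 4, c 5)])
    (B := [(t, u), (c 1, c 2), (c 4, c 5)]) ?_ ?_ ?_ ?_
  · simp at this
  · simp only [IsMatchingList, edgeFar_mk, List.mem_cons, List.not_mem_nil, or_false,
      forall_eq_or_imp, forall_eq, List.pairwise_cons, List.Pairwise.nil, and_true,
      IsEmpty.forall_iff, implies_true]
    exact ⟨⟨h0, h4⟩, H.edgeFar_c (by decide)⟩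
  · simp only [IsMatchingList, edgeFar_mk, List.mem_cons, List.not_mem_nil, or_false,
      forall_eq_or_imp, forall_eq, List.pairwise_cons, List.Pairwise.nil, and_true,
      IsEmpty.forall_iff, implies_true]
    have hf : ∀ j, j ≠ 0 → G.Far t (c j) ∧ G.Far u (c j) := fun j hj =>
      ⟨H.far_child_c ht hj.symm, H.far_grandchild_c ht hu⟩
    exact ⟨⟨(H.adj_child hu).symm, h1, h4⟩,
      ⟨⟨⟨(hf 1 (by decide)).1, (hf 2 (by decide)).1⟩, (hf 1 (by decide)).2, (hf 2 (by decide)).2⟩,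
        ⟨(hf 4 (by decide)).1, (hf 5 (by decide)).1⟩, (hf 4 (by decide)).2, (hf 5 (by decide)).2⟩,
      H.edgeFar_c (by decide)⟩
  · simp only [List.cons_append, List.nil_append, List.mem_cons, List.not_mem_nil, or_false,
      forall_eq_or_imp, forall_eq, H.core_c, true_and, and_true]
    exact ⟨H.core_child ht hX, H.core_grandchild ht hu hX⟩
  · simp only [List.mem_cons, List.not_mem_nil, or_false, forall_eq_or_imp, forall_eq]
    intro x y hxy hxX hyX hf
    have n1 := H.near_c 0 1 2 rfl rfl (x := x)
    have n2 := H.near_c 1 2 3 rfl rfl (x := x)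
    have h6 := H.adj_child ht
    have e0 := fun z (h : G.Adj t z) => H.eq_or_child ht h
    have e1 := fun z (h : G.Adj u z) => H.eq_or_child hu h
    have e4 := fun z p (h : Child par d z p) w (h' : G.Adj z w) => H.eq_or_child h h'
    have s := G.adj_comm
    simp only [Childless, Far] at *
    grind

/-- Trimming aside, only an edge from `c 3` to a leaf could be near `c 2 c 3` and yet far from both
`c 0 c 1` and `c 5 c 6`. If there is none, `c 0 c 1` can be traded for `c 0 t` and `c 2 c 3`. -/
lemma exists_childless_three [Finite V] (H : G.HangsFrom c par d) (hG : G.IsWellIndumatched)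
    (hs : ∀ i t, ¬ IsStar par d (c i) t) {t : V} (ht : Child par d t (c 0))
    (hl : Childless par d t) : ∃ t', Child par d t' (c 3) ∧ Childless par d t' := by
  by_contra! hs'
  have hX := hl.not_mem_deep
  have hcl := fun i z (hz : Child par d z (c i)) hz' =>
    (H.childless_or_isStar hz hz').resolve_right (hs i z)
  have h0 := H.adj_c 0 1 rfl
  have h1 := H.adj_c 1 2 rfl
  have h2 := H.adj_c 2 3 rfl
  have h3 := H.adj_c 3 4 rfl
  have h4 := H.adj_c 4 5 rfl
  have h5 := H.adj_c 5 6 rfl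
  have := H.length_le hG (X := deep par d) (fun _ h => h) (A := [(c 0, c 1), (c 5, c 6)])
    (B := [(c 0, t), (c 2, c 3), (c 5, c 6)]) ?_ ?_ ?_ ?_
  · simp at this
  · simp only [IsMatchingList, edgeFar_mk, List.mem_cons, List.not_mem_nil, or_false,
      forall_eq_or_imp, forall_eq, List.pairwise_cons, List.Pairwise.nil, and_true,
      IsEmpty.forall_iff, implies_true]
    exact ⟨⟨h0, h5⟩, H.edgeFar_c (by decide)⟩
  · simp only [IsMatchingList, edgeFar_mk, List.mem_cons, List.not_mem_nil, or_false,
      forall_eq_or_imp, forall_eq, List.pairwise_cons, List.Pairwise.nil, and_true,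
      IsEmpty.forall_iff, implies_true]
    exact ⟨⟨(H.adj_child ht).symm, h2, h5⟩,
      ⟨⟨⟨H.far_c (by decide), H.far_c (by decide)⟩,
          H.far_child_c ht (by decide), H.far_child_c ht (by decide)⟩,
        ⟨H.far_c (by decide), H.far_c (by decide)⟩,
        H.far_child_c ht (by decide), H.far_child_c ht (by decide)⟩,
      H.edgeFar_c (by decide)⟩
  · simp only [List.cons_append, List.nil_append, List.mem_cons, List.not_mem_nil, or_false,
      forall_eq_or_imp, forall_eq, H.core_c, true_and, and_true]
    exact H.core_child ht hX
  · simp only [List.mem_cons, List.not_mem_nil, or_false, forall_eq_or_imp, forall_eq]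
    intro x y hxy hxX hyX hf
    have n2 := H.near_c 1 2 3 rfl rfl (x := x)
    have m3 := H.near_c 2 3 4 rfl rfl (x := y)
    have n3 := H.near_c 2 3 4 rfl rfl (x := x)
    have hne := hxy.ne
    have k0 := H.adj_child ht
    have hcl3 := fun z hz hz' => hs' z hz (hcl 3 z hz hz')
    have hcl2 := hcl 2
    clear hs' hcl
    have e0 := fun z (h : G.Adj t z) => H.eq_or_child ht h
    have e4 := fun z p (h : Child par d z p) w (h' : G.Adj z w) => H.eq_or_child h h'
    have s := G.adj_comm
    simp only [Childless, Far] at *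
    grind

/-- The edge `c 0 c 1` is traded for the two leaf edges; `c 4 c 5` takes care of `c 3`. -/
lemma not_childless_two [Finite V] (H : G.HangsFrom c par d) (hG : G.IsWellIndumatched)
    (hs : ∀ i t, ¬ IsStar par d (c i) t) {t t' : V} (ht : Child par d t (c 0))
    (hl : Childless par d t) (ht' : Child par d t' (c 2)) (hl' : Childless par d t') : False := by
  have hX := hl.not_mem_deep
  have hX' := hl'.not_mem_deep
  have hcl := fun i z (hz : Child par d z (c i)) hz' =>
    (H.childless_or_isStar hz hz').resolve_right (hs i z)
  have h0 := H.adj_c 0 1 rfl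
  have h1 := H.adj_c 1 2 rfl
  have h2 := H.adj_c 2 3 rfl
  have h3 := H.adj_c 3 4 rfl
  have h4 := H.adj_c 4 5 rfl
  have := H.length_le hG (X := deep par d) (fun _ h => h) (A := [(c 0, c 1), (c 4, c 5)])
    (B := [(c 0, t), (c 2, t'), (c 4, c 5)]) ?_ ?_ ?_ ?_
  · simp at this
  · simp only [IsMatchingList, edgeFar_mk, List.mem_cons, List.not_mem_nil, or_false,
      forall_eq_or_imp, forall_eq, List.pairwise_cons, List.Pairwise.nil, and_true,
      IsEmpty.forall_iff, implies_true]
    exact ⟨⟨h0, h4⟩, H.edgeFar_c (by decide)⟩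
  · simp only [IsMatchingList, edgeFar_mk, List.mem_cons, List.not_mem_nil, or_false,
      forall_eq_or_imp, forall_eq, List.pairwise_cons, List.Pairwise.nil, and_true,
      IsEmpty.forall_iff, implies_true]
    have hne : c 0 ≠ c 2 := H.inj.ne (by decide)
    exact ⟨⟨(H.adj_child ht).symm, (H.adj_child ht').symm, h4⟩,
      ⟨⟨⟨H.far_c (by decide), (H.far_child_c ht' (by decide)).symm⟩,
          H.far_child_c ht (by decide), H.far_child_child ht ht' hne (by simp [H.depth_c])⟩,
        ⟨H.far_c (by decide), H.far_c (by decide)⟩,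
        H.far_child_c ht (by decide), H.far_child_c ht (by decide)⟩,
      ⟨H.far_c (by decide), H.far_c (by decide)⟩,
      H.far_child_c ht' (by decide), H.far_child_c ht' (by decide)⟩
  · simp only [List.cons_append, List.nil_append, List.mem_cons, List.not_mem_nil, or_false,
      forall_eq_or_imp, forall_eq, H.core_c, true_and, and_true]
    exact ⟨H.core_child ht hX, H.core_child ht' hX'⟩
  · simp only [List.mem_cons, List.not_mem_nil, or_false, forall_eq_or_imp, forall_eq]
    intro x y hxy hxX hyX hf
    have n2 := H.near_c 1 2 3 rfl rfl (x := x)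
    have e1 := fun z (h : G.Adj t' z) => H.eq_or_child ht' h
    have k0 := H.adj_child ht
    have e0 := fun z (h : G.Adj t z) => H.eq_or_child ht h
    have e4 := fun z p (h : Child par d z p) w (h' : G.Adj z w) => H.eq_or_child h h'
    have s := G.adj_comm
    simp only [Childless, Far] at *
    grind

/-- The edge `c 0 t` blocks `c 1` and `c 10`, leaving the path from `c 2` to `c 9`. Both two edges
and three edges of it can block the whole path. -/
lemma not_child_of_forall_hasGrandchild [Finite V] (H : G.HangsFrom c par d)
    (hG : G.IsWellIndumatched) (hd : ∀ i t, Child par d t (c i) → t ∈ deep par d) {t : V}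
    (ht : Child par d t (c 0)) : False := by
  have h0 := H.adj_c 0 1 rfl
  have h1 := H.adj_c 1 2 rfl
  have h2 := H.adj_c 2 3 rfl
  have h3 := H.adj_c 3 4 rfl
  have h4 := H.adj_c 4 5 rfl
  have h5 := H.adj_c 5 6 rfl
  have h6 := H.adj_c 6 7 rfl
  have h7 := H.adj_c 7 8 rfl
  have h8 := H.adj_c 8 9 rfl
  have h9 := H.adj_c 9 10 rfl
  have h10 := H.adj_c 10 0 rfl
  -- Children of `c 0` stay untrimmed, since `t` is needed in the core.
  have hX : ∀ i, i ≠ 0 → ∀ z, Child par d z (c i) → z ∈ {t ∈ deep par d | par t ≠ c 0} := by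
    intro i hi z hz
    refine ⟨hd i z hz, fun h => hi (H.inj ?_)⟩
    rw [← h, hz.2]
  have := H.length_le hG (X := {t ∈ deep par d | par t ≠ c 0}) (fun _ h => h.1)
    (A := [(c 0, t), (c 3, c 4), (c 7, c 8)])
    (B := [(c 0, t), (c 2, c 3), (c 5, c 6), (c 8, c 9)]) ?_ ?_ ?_ ?_
  · simp at this
  · simp only [IsMatchingList, edgeFar_mk, List.mem_cons, List.not_mem_nil, or_false,
      forall_eq_or_imp, forall_eq, List.pairwise_cons, List.Pairwise.nil, and_true,
      IsEmpty.forall_iff, implies_true]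
    exact ⟨⟨(H.adj_child ht).symm, h3, h7⟩,
      ⟨⟨⟨H.far_c (by decide), H.far_c (by decide)⟩,
          H.far_child_c ht (by decide), H.far_child_c ht (by decide)⟩,
        ⟨H.far_c (by decide), H.far_c (by decide)⟩,
        H.far_child_c ht (by decide), H.far_child_c ht (by decide)⟩,
      H.edgeFar_c (by decide)⟩
  · simp only [IsMatchingList, edgeFar_mk, List.mem_cons, List.not_mem_nil, or_false,
      forall_eq_or_imp, forall_eq, List.pairwise_cons, List.Pairwise.nil, and_true,
      IsEmpty.forall_iff, implies_true]
    exact ⟨⟨(H.adj_child ht).symm, h2, h5, h8⟩,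
      ⟨⟨⟨H.far_c (by decide), H.far_c (by decide)⟩,
          H.far_child_c ht (by decide), H.far_child_c ht (by decide)⟩,
        ⟨⟨H.far_c (by decide), H.far_c (by decide)⟩,
        H.far_child_c ht (by decide), H.far_child_c ht (by decide)⟩,
        ⟨H.far_c (by decide), H.far_c (by decide)⟩,
        H.far_child_c ht (by decide), H.far_child_c ht (by decide)⟩,
      ⟨H.edgeFar_c (by decide), H.edgeFar_c (by decide)⟩, H.edgeFar_c (by decide)⟩
  · simp only [List.cons_append, List.nil_append, List.mem_cons, List.not_mem_nil, or_false,
      forall_eq_or_imp, forall_eq, H.core_c, true_and, and_true]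
    have := H.core_child (X := {t ∈ deep par d | par t ≠ c 0}) ht fun h => h.2 ht.2
    exact ⟨this, this⟩
  · simp only [List.mem_cons, List.not_mem_nil, or_false, forall_eq_or_imp, forall_eq]
    intro x y hxy hxX hyX hf
    have n2 := H.near_c 1 2 3 rfl rfl (x := x)
    have n3 := H.near_c 2 3 4 rfl rfl (x := x)
    have n5 := H.near_c 4 5 6 rfl rfl (x := x)
    have n6 := H.near_c 5 6 7 rfl rfl (x := x)
    have n8 := H.near_c 7 8 9 rfl rfl (x := x)
    have n9 := H.near_c 8 9 10 rfl rfl (x := x)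
    have hX' : ∀ i, i ≠ 0 → ¬ Child par d x (c i) := fun i hi h => hxX (hX i hi x h)
    have m2 := hX' 2 (by decide)
    have m3 := hX' 3 (by decide)
    have m5 := hX' 5 (by decide)
    have m6 := hX' 6 (by decide)
    have m8 := hX' 8 (by decide)
    have m9 := hX' 9 (by decide)
    have s := G.adj_comm
    clear hX' hxX hX hd
    simp only [Far] at *
    grind

/-! ### Going round the cycle -/

/-- As 11 is prime, any nonzero step generates the indices; only the steps in use are checked. -/
lemma forall_fin_eleven_of_add {P : Fin 11 → Prop} (k : Fin 11) (hk : k = 1 ∨ k = 2 ∨ k = 3)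
    (h : ∀ i, P i → P (i + k)) {i : Fin 11} (hi : P i) (j : Fin 11) : P j := by
  have key : ∀ n : ℕ, P (i + n • k) := by
    intro n
    induction n with
    | zero => simpa using hi
    | succ n ih =>
      rw [succ_nsmul, ← add_assoc]
      exact h _ ih
  have hgen : ∀ k : Fin 11, k = 1 ∨ k = 2 ∨ k = 3 →
      ∀ i j : Fin 11, ∃ n : Fin 11, i + (n : ℕ) • k = j := by decide
  obtain ⟨n, hn⟩ := hgen k hk i j
  exact hn ▸ key n

/-- A well-indumatched graph consisting of a cycle of length eleven and hanging trees has no vertex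
off the cycle. -/
lemma surjective_of_isWellIndumatched [Finite V] (H : G.HangsFrom c par d)
    (hG : G.IsWellIndumatched) : Function.Surjective c := by
  have hs : ∀ i t, ¬ IsStar par d (c i) t := by
    intro i t ht
    have key := forall_fin_eleven_of_add (P := fun i => ∃ t, IsStar par d (c i) t) 2 (by decide)
      (fun i ⟨t, ht⟩ => (H.rotate i).exists_isStar_two hG (by simpa using ht)) ⟨t, ht⟩
    obtain ⟨t₀, h₀⟩ := key 0
    obtain ⟨t₁, h₁⟩ := key 1
    exact H.not_isStar_one hG h₀ h₁
  have hl : ∀ i t, Child par d t (c i) → ¬ Childless par d t := by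
    intro i t ht hl
    have key := forall_fin_eleven_of_add
      (P := fun i => ∃ t, Child par d t (c i) ∧ Childless par d t) 3 (by decide)
      (fun i ⟨t, ht, hl⟩ => (H.rotate i).exists_childless_three hG (fun _ _ => hs _ _)
        (by simpa using ht) hl) ⟨t, ht, hl⟩
    obtain ⟨t₀, h₀, h₀'⟩ := key 0
    obtain ⟨t₂, h₂, h₂'⟩ := key 2
    exact H.not_childless_two hG hs h₀ h₀' h₂ h₂'
  have hd : ∀ i t, Child par d t (c i) → t ∈ deep par d := by
    intro i t ht
    by_contra h
    rcases H.childless_or_isStar ht h with h | h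
    exacts [hl i t ht h, hs i t h]
  have hc : ∀ i t, ¬ Child par d t (c i) := fun i t ht =>
    (H.rotate i).not_child_of_forall_hasGrandchild hG (fun _ => hd _) (by simpa using ht)
  have hdepth : ∀ n v, d v ≠ n + 1 := by
    intro n
    induction n with
    | zero =>
      intro v hv
      have h1 := H.depth_par v (by omega)
      obtain ⟨i, hi⟩ := H.exists_c (par v) (by omega)
      exact hc i v ⟨by omega, hi.symm⟩
    | succ n ih =>
      intro v hv
      have h1 := H.depth_par v (by omega)
      exact ih (par v) (by omega)
  intro v
  refine H.exists_c v ?_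
  rcases h : d v with _ | n
  · rfl
  · exact absurd h (hdepth n v)

end HangsFrom

/-! ### Structure of unicyclic graphs of girth 11 -/

/-- A function measuring the distance to the range of `c`. -/
lemma Connected.exists_depth {ι : Type*} [Finite ι] [Nonempty ι] (hG : G.Connected) (c : ι → V) :
    ∃ d : V → ℕ, (∀ i, d (c i) = 0) ∧ (∀ v, d v = 0 → ∃ i, c i = v) ∧
      (∀ u v, G.Adj u v → d u ≤ d v + 1) ∧ ∀ v, d v ≠ 0 → ∃ p, G.Adj v p ∧ d p + 1 = d v := by
  have hmin : ∀ v, ∃ i, ∀ j, G.dist v (c i) ≤ G.dist v (c j) := fun v => Finite.exists_min _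
  choose n hn using hmin
  have hstep : ∀ u v, G.Adj u v → G.dist u (c (n u)) ≤ G.dist v (c (n v)) + 1 := by
    intro u v h
    have h1 := hn u (n v)
    have h2 := hG.dist_triangle (u := u) (v := v) (w := c (n v))
    rw [dist_eq_one_iff_adj.2 h] at h2
    omega
  refine ⟨fun v => G.dist v (c (n v)), fun i => ?_, fun v hv => ⟨n v, ?_⟩, hstep, fun v hv => ?_⟩
  · have := hn (c i) i
    rw [dist_self] at this
    simpa using this
  · exact (hG.dist_eq_zero_iff.1 hv).symm
  · obtain ⟨q, hq⟩ := hG.exists_walk_length_eq_dist v (c (n v))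
    have key : ∀ {w} (q : G.Walk v w), q.length = G.dist v w → G.dist v w ≠ 0 →
        ∃ p, G.Adj v p ∧ G.dist p w + 1 ≤ G.dist v w := by
      intro w q hq hv
      cases q with
      | nil => simp at hv
      | cons h q =>
        refine ⟨_, h, ?_⟩
        rw [← hq, Walk.length_cons]
        exact Nat.succ_le_succ (dist_le q)
    obtain ⟨p, h, hp⟩ := key q hq hv
    refine ⟨p, h, ?_⟩
    have h1 := hn p (n v)
    have h3 := hstep v p h
    simp only at *
    omega

/-- If every edge off the closed walk `c` of length eleven is a bridge, then the graph is the cycle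
`c` with hanging trees. -/
lemma Connected.exists_hangsFrom (hG : G.Connected) {c : Fin 11 → V} (hc : Function.Injective c)
    (hadj : ∀ i, G.Adj (c i) (c (i + 1)))
    (hb : ∀ x y, G.Adj x y → (¬ ∃ i, s(x, y) = s(c i, c (i + 1))) → G.IsBridge s(x, y)) :
    ∃ par d, G.HangsFrom c par d := by
  obtain ⟨d, hd0, hd, hle, hpar⟩ := hG.exists_depth c
  choose! par hpadj hpd using hpar
  have hcyc : ∀ x y, (¬ ∃ i, s(x, y) = s(c i, c (i + 1))) → ∀ i j,
      (G.deleteEdges {s(x, y)}).Reachable (c i) (c j) := by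
    intro x y hxy i j
    refine HangsFrom.forall_fin_eleven_of_add
      (P := fun j => (G.deleteEdges {s(x, y)}).Reachable (c i) (c j)) 1 (by decide)
      (fun j hj => hj.trans (Adj.reachable ?_)) (Reachable.refl (c i)) j
    rw [deleteEdges_adj]
    refine ⟨hadj j, fun h => hxy ⟨j, ?_⟩⟩
    exact (Set.mem_singleton_iff.1 h).symm
  -- Descending from `w` along `par` uses only edges with both ends of depth at most `d w`, hence
  -- never `s(x, y)`.
  have hreach : ∀ x y n w, d w = n → (n < d x ∨ n < d y) →
      ∃ i, (G.deleteEdges {s(x, y)}).Reachable w (c i) := by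
    intro x y n
    induction n with
    | zero =>
      intro w hw _
      obtain ⟨i, rfl⟩ := hd w hw
      exact ⟨i, Reachable.refl _⟩
    | succ n ih =>
      intro w hw hn
      have h0 : d w ≠ 0 := by omega
      have h1 := hpd w h0
      obtain ⟨i, hi⟩ := ih (par w) (by omega) (by omega)
      refine ⟨i, Reachable.trans (Adj.reachable ?_) hi⟩
      rw [deleteEdges_adj]
      refine ⟨hpadj w h0, fun h => ?_⟩
      rw [Set.mem_singleton_iff, Sym2.eq_iff] at h
      rcases h with ⟨rfl, rfl⟩ | ⟨rfl, rfl⟩ <;> omega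
  have hreach' : ∀ x y, G.Adj x y → d y ≤ d x → (d x ≠ 0 → par x ≠ y) →
      ∃ i, (G.deleteEdges {s(x, y)}).Reachable x (c i) := by
    intro x y hxy hyx hne
    by_cases h0 : d x = 0
    · obtain ⟨i, rfl⟩ := hd x h0
      exact ⟨i, Reachable.refl _⟩
    have h1 := hpd x h0
    obtain ⟨i, hi⟩ := hreach x y _ (par x) rfl (by omega)
    refine ⟨i, Reachable.trans (Adj.reachable ?_) hi⟩
    rw [deleteEdges_adj]
    refine ⟨hpadj x h0, fun h => ?_⟩
    rw [Set.mem_singleton_iff, Sym2.eq_iff] at h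
    rcases h with ⟨_, h⟩ | ⟨h, _⟩
    · exact hne h0 h
    · exact hxy.ne h
  have hcontra : ∀ x y, G.Adj x y → (¬ ∃ i, s(x, y) = s(c i, c (i + 1))) →
      (∃ i, (G.deleteEdges {s(x, y)}).Reachable x (c i)) →
      (∃ i, (G.deleteEdges {s(x, y)}).Reachable y (c i)) → False := by
    rintro x y hxy hn ⟨i, hi⟩ ⟨j, hj⟩
    exact isBridge_iff.1 (hb x y hxy hn) (hi.trans ((hcyc x y hn i j).trans hj.symm))
  -- An edge that is neither on the cycle nor a parent edge is no bridge: both its ends reach the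
  -- cycle without it.
  have hlt : ∀ x y, G.Adj x y → (¬ ∃ i, s(x, y) = s(c i, c (i + 1))) → d y ≤ d x →
      d x ≠ 0 ∧ par x = y := by
    intro x y hxy hn hyx
    by_contra h
    have h' : d x ≠ 0 → par x ≠ y := by simpa using h
    refine hcontra x y hxy hn (hreach' x y hxy hyx h') ?_
    rcases hyx.lt_or_eq with hlt | heq
    · exact hreach x y _ y rfl (Or.inl hlt)
    · obtain ⟨i, hi⟩ := hreach' y x hxy.symm heq.ge fun h0 h1 => by
        have := hpd y h0
        rw [h1] at this
        omega
      exact ⟨i, by rwa [Sym2.eq_swap] at hi⟩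
  refine ⟨par, d, hc, hd0, hd, hpd, fun u v => ⟨fun h => ?_, ?_⟩⟩
  · by_cases hn : ∃ i, s(u, v) = s(c i, c (i + 1))
    · obtain ⟨i, hi⟩ := hn
      rcases Sym2.eq_iff.1 hi with ⟨h1, h2⟩ | ⟨h1, h2⟩
      exacts [Or.inl ⟨i, Or.inl ⟨h1, h2⟩⟩, Or.inl ⟨i, Or.inr ⟨h2, h1⟩⟩]
    · rcases le_total (d u) (d v) with hle | hle
      · exact Or.inr (Or.inl (hlt v u h.symm (by rwa [Sym2.eq_swap]) hle))
      · exact Or.inr (Or.inr (hlt u v h hn hle))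
  · rintro (⟨i, ⟨rfl, rfl⟩ | ⟨rfl, rfl⟩⟩ | ⟨h, rfl⟩ | ⟨h, rfl⟩)
    exacts [hadj i, (hadj i).symm, (hpadj v h).symm, hpadj u h]

lemma IsUnicyclic.exists_hangsFrom (hG : G.IsUnicyclic) (hg : G.girth = 11) :
    ∃ (c : Fin 11 → V) (par : V → V) (d : V → ℕ), G.HangsFrom c par d := by
  obtain ⟨hconn, huniq⟩ := hG
  have hacyc : ¬ G.IsAcyclic := by
    -- Acyclic graphs have `girth` 0 by convention.
    rw [← girth_eq_zero, hg]
    decide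
  obtain ⟨a, w, hw, hlen⟩ := exists_girth_eq_length.2 hacyc
  rw [hg] at hlen
  -- At `i = 10` the left index wraps to 0 and the right one is 11, the end of the closed walk.
  have hsucc : ∀ i : Fin 11, w.getVert ((i + 1 : Fin 11) : ℕ) = w.getVert ((i : ℕ) + 1) := by
    intro i
    by_cases hi : i = 10
    · subst hi
      have : w.getVert 11 = w.getVert 0 := by
        rw [Walk.getVert_zero, hlen, Walk.getVert_length]
      exact this.symm
    · congr 1
      revert i
      decide
  have hadj : ∀ i : Fin 11, G.Adj (w.getVert i) (w.getVert ((i + 1 : Fin 11) : ℕ)) := by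
    intro i
    rw [hsucc]
    exact w.adj_getVert_succ (by omega)
  refine ⟨fun i => w.getVert i, hconn.exists_hangsFrom ?_ hadj ?_⟩
  · intro i j hij
    exact Fin.ext (hw.getVert_injOn' (by simp; omega) (by simp; omega) hij)
  · intro x y hxy hn
    rw [isBridge_iff_forall_cycle_notMem hxy]
    intro b p hp hmem
    -- By uniqueness, a cycle through the edge would be `w`, but the edge is not on `w`.
    have heq : p.toSubgraph = w.toSubgraph := huniq.unique ⟨b, p, hp, rfl⟩ ⟨a, w, hw, rfl⟩
    rw [← Walk.mem_edges_toSubgraph, heq, Subgraph.mem_edgeSet, Walk.toSubgraph_adj_iff] at hmem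
    obtain ⟨i, hi, hlt⟩ := hmem
    refine hn ⟨⟨i, by omega⟩, ?_⟩
    rw [hsucc]
    exact hi.symm

/-! ### The cycle of length eleven -/

lemma adj_iff_of_iso (φ : G ≃g cycleGraph 11) (i j : Fin 11) :
    G.Adj (φ.symm i) (φ.symm j) ↔ i - j = 1 ∨ j - i = 1 := by
  rw [φ.symm.map_adj_iff, cycleGraph_adj]

lemma far_iff_of_iso (φ : G ≃g cycleGraph 11) (i j : Fin 11) :
    G.Far (φ.symm i) (φ.symm j) ↔ i ≠ j ∧ i - j ≠ 1 ∧ j - i ≠ 1 := by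
  rw [Far, adj_iff_of_iso, not_or]
  simp

/-- Edges are far exactly when their indices differ cyclically by at least 3; disjoint triples turn
this into a packing problem. -/
lemma edgeFar_iff_of_iso (φ : G ≃g cycleGraph 11) (i j : Fin 11) :
    G.EdgeFar s(φ.symm i, φ.symm (i + 1)) s(φ.symm j, φ.symm (j + 1)) ↔
      Disjoint ({i, i + 1, i + 2} : Finset (Fin 11)) {j, j + 1, j + 2} := by
  simp only [edgeFar_mk, far_iff_of_iso]
  revert i j
  decide

lemma edge_eq_of_iso (φ : G ≃g cycleGraph 11) {e : Sym2 V} (he : e ∈ G.edgeSet) :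
    ∃ i, s(φ.symm i, φ.symm (i + 1)) = e := by
  induction e with
  | _ x y =>
  obtain ⟨i, rfl⟩ := φ.symm.surjective x
  obtain ⟨j, rfl⟩ := φ.symm.surjective y
  rcases (adj_iff_of_iso φ i j).1 he with h | h
  · exact ⟨j, by rw [← h, add_sub_cancel, Sym2.eq_swap]⟩
  · exact ⟨i, by rw [← h, add_sub_cancel]⟩

/-- All maximal induced matchings of a cycle of length eleven have three edges. -/
lemma card_eq_three_of_iso (φ : G ≃g cycleGraph 11) {M : Finset (Sym2 V)}
    (hM : Maximal G.IsInducedMatching M) : M.card = 3 := by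
  classical
  set f : Fin 11 → Sym2 V := fun i => s(φ.symm i, φ.symm (i + 1)) with hf
  have hfadj : ∀ i, f i ∈ G.edgeSet := fun i => (adj_iff_of_iso φ _ _).2 (by simp)
  have hinj : Function.Injective f := by
    intro i j h
    simp only [hf, Sym2.eq_iff, φ.symm.injective.eq_iff] at h
    revert i j
    decide
  obtain ⟨hM1, hM2⟩ := isInducedMatching_iff.1 hM.prop
  set S : Finset (Fin 11) := Finset.univ.filter fun i => f i ∈ M with hS
  have hMS : M = S.image f := by
    ext e
    simp only [hS, Finset.mem_image, Finset.mem_filter, Finset.mem_univ, true_and]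
    constructor
    · intro he
      obtain ⟨i, rfl⟩ := edge_eq_of_iso φ (hM1 e he)
      exact ⟨i, he, rfl⟩
    · rintro ⟨i, hi, rfl⟩
      exact hi
  have hupper : 3 * S.card ≤ 11 := by
    have hdisj : ∀ i ∈ S, ∀ j ∈ S, i ≠ j →
        Disjoint ({i, i + 1, i + 2} : Finset (Fin 11)) {j, j + 1, j + 2} := by
      intro i hi j hj hij
      rw [← edgeFar_iff_of_iso φ]
      exact hM2 _ (by simpa [hS] using hi) _ (by simpa [hS] using hj) (hinj.ne hij)
    have h3 : ∀ i : Fin 11, ({i, i + 1, i + 2} : Finset (Fin 11)).card = 3 := by decide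
    have := Finset.card_biUnion hdisj
    rw [Finset.sum_congr rfl fun i _ => h3 i, Finset.sum_const, smul_eq_mul] at this
    have hle := Finset.card_le_univ (S.biUnion fun i => {i, i + 1, i + 2})
    rw [Fintype.card_fin] at hle
    omega
  -- By maximality each of the 11 edges is near one in `M`, and an edge is near only five edges,
  -- itself included.
  have hlower : 11 ≤ S.card * 5 := by
    have hcover : ∀ j, ∃ i ∈ S, ¬ G.EdgeFar (f i) (f j) := by
      intro j
      by_contra! h
      have hins : G.IsInducedMatching (M ∪ {f j}) := by
        refine hM.prop.union ?_ ?_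
        · rw [isInducedMatching_iff]
          simp only [Finset.mem_singleton]
          exact ⟨fun e he => he ▸ hfadj j, fun e he f hf hne => (hne (he.trans hf.symm)).elim⟩
        · intro e he f' hf'
          rw [hMS] at he
          obtain ⟨i, hi, rfl⟩ := Finset.mem_image.1 he
          rw [Finset.mem_singleton.1 hf']
          exact h i hi
      have hj : f j ∈ M :=
        hM.le_of_ge hins Finset.subset_union_left (Finset.mem_union_right _ (by simp))
      exact (h j (by simpa [hS] using hj)).ne rfl
    have hsub : (Finset.univ : Finset (Fin 11)) ⊆
        S.biUnion fun i => {i - 2, i - 1, i, i + 1, i + 2} := by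
      intro j _
      obtain ⟨i, hi, hij⟩ := hcover j
      refine Finset.mem_biUnion.2 ⟨i, hi, ?_⟩
      rw [edgeFar_iff_of_iso] at hij
      clear hi
      revert i j
      decide
    have h5 : ∀ i : Fin 11, ({i - 2, i - 1, i, i + 1, i + 2} : Finset (Fin 11)).card ≤ 5 := by
      decide
    simpa using (Finset.card_le_card hsub).trans
      (Finset.card_biUnion_le_card_mul _ _ 5 fun i _ => h5 i)
  rw [hMS, Finset.card_image_of_injective _ hinj]
  omega

/-- A vertex on a cycle has two neighbours in it and at most two in `G`, so the cycle contains all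
its neighbours and, by connectedness, everything. -/
lemma toSubgraph_eq_top_of_iso (φ : G ≃g cycleGraph 11) {a : V} {w : G.Walk a a}
    (hw : w.IsCycle) : w.toSubgraph = ⊤ := by
  have hconn : G.Connected := φ.connected_iff.2 cycleGraph_connected
  have hnbr : ∀ x ∈ w.support, w.toSubgraph.neighborSet x = G.neighborSet x := by
    intro x hx
    have hsub : G.neighborSet x ⊆ {φ.symm (φ x - 1), φ.symm (φ x + 1)} := by
      intro y hy
      obtain ⟨i, rfl⟩ := φ.symm.surjective x
      obtain ⟨j, rfl⟩ := φ.symm.surjective y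
      rcases (adj_iff_of_iso φ i j).1 hy with h | h
      · left
        rw [← h]
        simp
      · right
        rw [← h]
        simp
    have hfin : ({φ.symm (φ x - 1), φ.symm (φ x + 1)} : Set V).Finite := by simp
    refine Set.eq_of_subset_of_ncard_le (w.toSubgraph.neighborSet_subset x) ?_ (hfin.subset hsub)
    rw [hw.ncard_neighborSet_toSubgraph_eq_two hx]
    exact (Set.ncard_le_ncard hsub hfin).trans ((Set.ncard_insert_le _ _).trans (by simp))
  have hall : ∀ x, x ∈ w.support := by
    intro x
    obtain ⟨p⟩ := hconn.preconnected x a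
    induction p with
    | nil => exact w.start_mem_support
    | @cons x y _ h p ih =>
      have hy := ih hw hnbr
      have : x ∈ w.toSubgraph.neighborSet y := by
        rw [hnbr _ hy]
        exact h.symm
      exact (w.mem_verts_toSubgraph).1 (w.toSubgraph.edge_vert (Subgraph.Adj.symm this))
  refine Subgraph.ext ?_ ?_
  · ext x
    simp [hall x]
  · ext x y
    have := hnbr x (hall x)
    rw [Set.ext_iff] at this
    simpa using this y

theorem isUnicyclic_of_iso (φ : G ≃g cycleGraph 11) : G.IsUnicyclic := by
  refine ⟨φ.connected_iff.2 cycleGraph_connected, ⊤, ?_, ?_⟩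
  · have hw : ((cycleGraph.cycle 8).map φ.symm.toHom).IsCycle :=
      cycleGraph.isCycle_cycle.map φ.symm.injective
    exact ⟨_, _, hw, toSubgraph_eq_top_of_iso φ hw⟩
  · rintro C ⟨a, w, hw, rfl⟩
    exact toSubgraph_eq_top_of_iso φ hw

theorem girth_eq_eleven_of_iso (φ : G ≃g cycleGraph 11) : G.girth = 11 := by
  rw [φ.girth_eq]
  have h0 : (cycleGraph.cycle 8).IsCycle := cycleGraph.isCycle_cycle
  obtain ⟨a, w, hw, hlen⟩ := exists_girth_eq_length.2 fun h => h _ h0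
  -- A shortest cycle and the standard one have the same edges, hence the same length.
  have heq := (toSubgraph_eq_top_of_iso Iso.refl hw).trans
    (toSubgraph_eq_top_of_iso Iso.refl h0).symm
  have hperm : w.edges.Perm (cycleGraph.cycle 8).edges := by
    rw [List.perm_ext_iff_of_nodup hw.edges_nodup h0.edges_nodup]
    intro e
    rw [← Walk.mem_edges_toSubgraph, heq, Walk.mem_edges_toSubgraph]
  rw [hlen, ← Walk.length_edges, hperm.length_eq, Walk.length_edges, cycleGraph.length_cycle]

lemma HangsFrom.nonempty_iso {c : Fin 11 → V} {par : V → V} {d : V → ℕ}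
    (H : G.HangsFrom c par d) (hc : Function.Surjective c) : Nonempty (G ≃g cycleGraph 11) := by
  refine ⟨Iso.symm ⟨Equiv.ofBijective c ⟨H.inj, hc⟩, fun {i j} => ?_⟩⟩
  change G.Adj (c i) (c j) ↔ _
  rw [cycleGraph_adj, H.adj_iff]
  simp only [H.inj.eq_iff, H.depth_c, ne_eq, not_true_eq_false, false_and, or_false]
  revert i j
  decide

end SimpleGraph

theorem mainTheorem8 {V : Type*} [Finite V] (G : SimpleGraph V) :
    (G.IsUnicyclic ∧ G.girth = 11 ∧ G.IsWellIndumatched) ↔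
      Nonempty (G ≃g SimpleGraph.cycleGraph 11) := by
  constructor
  · rintro ⟨hu, hg, hw⟩
    obtain ⟨c, par, d, H⟩ := hu.exists_hangsFrom hg
    exact H.nonempty_iso (H.surjective_of_isWellIndumatched hw)
  · rintro ⟨φ⟩
    exact ⟨SimpleGraph.isUnicyclic_of_iso φ, SimpleGraph.girth_eq_eleven_of_iso φ,
      fun M N hM hN => (SimpleGraph.card_eq_three_of_iso φ hM).trans
        (SimpleGraph.card_eq_three_of_iso φ hN).symm⟩
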